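/- **Arm.** Consider a serial arm with $n$ revolute joints. Joint $i\in\{1,\dots,n\}$ rotates link $i$ relative to link $i-1$ by $R_i(\theta)=C_i\,\mathrm{Rot}(a_i,\theta)\in SO(3)$, where $C_i\in SO(3)$ is fixed and $a_i\in\mathbb R^3$ is a unit axis. Let $l_i\in\mathbb R^3$ be the link displacements, $L_i\subset\mathbb R^3$ the link volumes, $q_i^-,q_i^+$ the position limits, $\dot q_{i,\lim}$ the speed limits and $\ddot q_{i,\lim}$ the acceleration limits. Link $i$ occupies $$\mathrm{FO}_i(q)=\Big\{\sum_{1\le j<i}R_1(q_1)\cdots R_j(q_j)\,l_j\Big\}\oplus R_1(q_1)\cdots R_i(q_i)L_i ,\qquad \mathrm{FO}(q)=\bigcup_i \mathrm{FO}_i(q).$$ **Trajectories.** Let $0<t_{plan}<t_f$, $T=[0,t_f]$, and let $T$ be divided into $N\ge1$ steps $T_0,\dots,T_{N-1}$ of length $\Delta t=t_f/N$; write $s(t)=\min(\lfloor t/\Delta t\rfloor,N-1)$. For $k_v,k_a\in\mathbb R$ let $\dot q(t;k_v,k_a)=k_v+k_at$ for $t<t_{plan}$ and $\dot q(t;k_v,k_a)=\frac{k_v+k_at_{plan}}{t_f-t_{plan}}(t_f-t)$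 for $t\ge t_{plan}$, and $q(t;k_v,k_a)=\int_0^t\dot q$. The parameters of joint $i$ range over $K^v_i=[\bar k^v_i-\Delta^v_i,\bar k^v_i+\Delta^v_i]$ and $K^a_i=[\bar k^a_i-\Delta^a_i,\bar k^a_i+\Delta^a_i]\cap[-\ddot q_{i,\lim},\ddot q_{i,\lim}]$, with $\Delta^v_i,\Delta^a_i>0$. The initial state is $\hat q\in\mathbb R^n$, $\hat{\dot q}_i\in K^v_i$, and $k_a=(k_{a,1},\dots,k_{a,n})$ parameterizes the plan with joint angles $\hat q_i+q(t;\hat{\dot q}_i,k_{a,i})$. **Joint reachable sets.** A *zonotope* is a set $\{x+\sum_{j\le p}\beta_jg^j: |\beta_j|\le1\}$. A *JRS representation* is a family of zonotopes $J_i(s)\subset\mathbb R^4$ ($1\le i\le n$, $0\le s<N$) such that $J_i(s)\ni(\cos q(t;k_v,k_a),\sin q(t;k_v,k_a),k_v,k_a)$ for all $t\in T_s$, $k_v\in K^v_i$, $k_a\in K^a_i$; the last two coordinates of the center are $\bar k^v_i,\bar k^a_i$; those of one generator $g_i^v$ are $(\Delta^v_i,0)$, those of a second generator $g_i^a$ are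 $(0,\Delta^a_i)$, and those of all other generators are $0$. **Reachable set of the arm.** Let link volumes and obstacles be enclosed by zonotopes: $L_i\subseteq \tilde L_i$ and $O\subseteq\tilde O$ for each of the finitely many compact obstacles $O\in\mathcal O$. Give the generators of $J_i(s)$ and $\tilde L_i$ distinct indeterminate coefficients, $\lambda_i$ being that of $g_i^a$. Slice $J_i(s)$ by setting the coefficient of $g_i^v$ to $(\hat{\dot q}_i-\bar k^v_i)/\Delta_i^v$ and adding that multiple of $g_i^v$ to the center. Reshape the (cosine, sine) part of the result into a matrix zonotope $M_i(s)$ and multiply it from the left by $R_i(\hat q_i)$: a pair $(c,\sigma)$ becomes $c(I-a_ia_i^\top)+\sigma[a_i]_\times$, plus $a_ia_i^\top$ for the center. Let $$V_i(s)=\bigoplus_{1\le j<i}M_1(s)\cdots M_j(s)\{l_j\}\ \oplus\ M_1(s)\cdots M_i(s)\tilde L_i ,$$ where products are multiplied out, so that each generator carries a product of indeterminates, and $\oplus$ adds centers and collects generators. Let $V_i^{slc}(s)$ consist of the center of $V_i(s)$ and of those generators whose indeterminates are all among $\lambda_1,\dots,\lambda_n$, and let $x_i(s,k_a)\in\mathbb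 R^3$ be its value at $\lambda_m=(k_{a,m}-\bar k^a_m)/\Delta^a_m$. Let $V_i^{buf}(s)$ be the zonotope with center $0$ and all other generators of $V_i(s)$, each with its own independent coefficient in $[-1,1]$. **Constraints.** For all $i,s,O$ let $(A,b)=(A,b)(i,s,O)$ be any half-space representation of $\tilde O\oplus V_i^{buf}(s)$, that is, finitely many inequalities with $Az-b\le0$ (elementwise) iff $z\in\tilde O\oplus V_i^{buf}(s)$. With these at $s=s(t)$, put $$h_{obs}(i,t,O,k_a)=-\max\big(A\,x_i(s(t),k_a)-b\big).$$ Let $h_{lim}(k_a)$ be the maximum of $q_i^--\theta_i(t)$, $\theta_i(t)-q_i^+$ and $|\dot q(t;\hat{\dot q}_i,k_{a,i})|-\dot q_{i,\lim}$, with $\theta_i(t)=\hat q_i+q(t;\hat{\dot q}_i,k_{a,i})$, over all joints $i$ and over the possible extremal times $t$: $0$, $t_{plan}$, $t_f$ and the zero $-\hat{\dot q}_i/k_{a,i}$ of the velocity, projected to $[0,t_{plan}]$ (if $k_{a,i}=0$, the time $0$ is used instead). **Theorem.** JRS representations exist. For every JRS representation, all enclosing zonotopes and all half-space representations as above: if $k_{a,i}\in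 K^a_i$ for all $i$, $h_{obs}(i,t,O,k_a)<0$ for all $i\in\{1,\dots,n\}$, $t\in T$, $O\in\mathcal O$, and $h_{lim}(k_a)<0$, then for all $t\in T$ $$\mathrm{FO}\big(\hat q+q(t;\hat{\dot q},k_a)\big)\cap O=\emptyset\quad\text{for all }O\in\mathcal O,$$ and, for every joint $i$, $q_i^-\le\hat q_i+q(t;\hat{\dot q}_i,k_{a,i})\le q_i^+$ and $|\dot q(t;\hat{\dot q}_i,k_{a,i})|\le\dot q_{i,\lim}$. -/

import Mathlib

open scoped Pointwise

noncomputable section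

/-- Vectors of the workspace `ℝ³`. -/
abbrev Vec3 := Fin 3 → ℝ

/-- `3 × 3` real matrices. -/
abbrev Mat3 := Matrix (Fin 3) (Fin 3) ℝ

/-! ### The arm -/

/-- The cross-product matrix `[a]ₓ`, with `[a]ₓ v = a × v`. -/
def crossMat (a : Vec3) : Mat3 :=
  !![0, -a 2, a 1; a 2, 0, -a 0; -a 1, a 0, 0]

/-- The matrix `c (I - a aᵀ) + s [a]ₓ`, linear in `(c, s)`. For `a = (0,0,1)` this is
`!![c, -s, 0; s, c, 0; 0, 0, 0]`. -/
def axisLin (a : Vec3) (c s : ℝ) : Mat3 :=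
  c • (1 - Matrix.vecMulVec a a) + s • crossMat a

/-- Rotation by the angle `θ` about the unit axis `a`. -/
def axisRot (a : Vec3) (θ : ℝ) : Mat3 :=
  axisLin a (Real.cos θ) (Real.sin θ) + Matrix.vecMulVec a a

/-- A serial arm with `n` single-axis revolute joints; joint `i` joins link `i` to its predecessor
(indices are shifted to start at `0`; the link moved by the first joint has index `0`).
`mount i` is the fixed rotation of the frame of link `i` relative to its predecessor at angle `0`. -/
structure Arm (n : ℕ) where
  axis : Fin n → Vec3
  axis_unit : ∀ i, axis i ⬝ᵥ axis i = 1
  mount : Fin n → Mat3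
  mount_mem : ∀ i, mount i ∈ Matrix.specialOrthogonalGroup (Fin 3) ℝ
  /-- displacement `l i` along link `i`, from its predecessor joint to its successor joint -/
  disp : Fin n → Vec3
  /-- volume `L i` of link `i`, in the frame of link `i` -/
  vol : Fin n → Set Vec3
  /-- minimum joint positions -/
  qmin : Fin n → ℝ
  /-- maximum joint positions -/
  qmax : Fin n → ℝ
  /-- maximum absolute joint speeds -/
  dqmax : Fin n → ℝ
  /-- maximum absolute joint accelerations -/
  ddqmax : Fin n → ℝ

namespace Arm

variable {n : ℕ}

/-- The rotation `R_i(θ)` of link `i` relative to its predecessor. -/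
def R (arm : Arm n) (i : Fin n) (θ : ℝ) : Mat3 :=
  arm.mount i * axisRot (arm.axis i) θ

/-- The ordered product `∏_{m ≤ j} R_m(q_m)`. -/
def prodR (arm : Arm n) (q : Fin n → ℝ) (j : Fin n) : Mat3 :=
  (((List.finRange n).filter (fun m => m ≤ j)).map (fun m => arm.R m (q m))).prod

/-- Forward occupancy of link `i`. -/
def FOlink (arm : Arm n) (i : Fin n) (q : Fin n → ℝ) : Set Vec3 :=
  {∑ j ∈ Finset.univ.filter (fun j => j < i), (arm.prodR q j).mulVec (arm.disp j)} +
    (fun y => (arm.prodR q i).mulVec y) '' arm.vol i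

/-- Forward occupancy of the entire arm. -/
def FO (arm : Arm n) (q : Fin n → ℝ) : Set Vec3 := ⋃ i, arm.FOlink i q

end Arm

/-! ### Parameterized trajectories -/

/-- Timing of a plan over `[0, tf]`, number `N` of time steps, and centers and half-widths of the
ranges of the velocity and acceleration parameters. -/
structure PlanSpec (n : ℕ) where
  tplan : ℝ
  tf : ℝ
  tplan_pos : 0 < tplan
  tplan_lt : tplan < tf
  N : ℕ
  N_pos : 0 < N
  kvc : Fin n → ℝ
  dkv : Fin n → ℝ
  dkv_pos : ∀ i, 0 < dkv i
  kac : Fin n → ℝ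
  dka : Fin n → ℝ
  dka_pos : ∀ i, 0 < dka i

namespace PlanSpec

variable {n : ℕ}

/-- The length `Δt` of a time step. -/
def dt (P : PlanSpec n) : ℝ := P.tf / P.N

/-- The joint velocity at time `t` with initial velocity `kv` and acceleration parameter `ka`:
constant acceleration on `[0, tplan)`, then constant braking to a stop at `tf`. -/
def dq (P : PlanSpec n) (kv ka t : ℝ) : ℝ :=
  if t < P.tplan then kv + ka * t
  else (kv + ka * P.tplan) / (P.tf - P.tplan) * (P.tf - t)

/-- The joint displacement at time `t`: the antiderivative of `dq` that vanishes at time `0`. -/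
def q (P : PlanSpec n) (kv ka t : ℝ) : ℝ := ∫ u in (0 : ℝ)..t, P.dq kv ka u

/-- Range of the velocity parameter of joint `i`. -/
def Kv (P : PlanSpec n) (i : Fin n) : Set ℝ :=
  Set.Icc (P.kvc i - P.dkv i) (P.kvc i + P.dkv i)

/-- Range of the acceleration parameter of joint `i`, cut off at the acceleration limits. -/
def Ka (P : PlanSpec n) (arm : Arm n) (i : Fin n) : Set ℝ :=
  Set.Icc (max (-arm.ddqmax i) (P.kac i - P.dka i)) (min (arm.ddqmax i) (P.kac i + P.dka i))

/-- The index of the time step that contains `t` (the final time belongs to the last step). -/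
def step (P : PlanSpec n) (t : ℝ) : Fin P.N :=
  ⟨min ⌊t / P.dt⌋₊ (P.N - 1), by have := P.N_pos; omega⟩

end PlanSpec

/-! ### Zonotopes, and zonotope-like objects with indeterminates -/

/-- A zonotope: a center and finitely many generators. -/
structure Zonotope (E : Type) where
  center : E
  p : ℕ
  gen : Fin p → E

namespace Zonotope

variable {E : Type} [AddCommGroup E] [Module ℝ E]

/-- The points of a zonotope. -/
def toSet (Z : Zonotope E) : Set E :=
  {y | ∃ β : Fin Z.p → ℝ, (∀ j, β j ∈ Set.Icc (-1 : ℝ) 1) ∧ y = Z.center + ∑ j, β j • Z.gen j}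

/-- Minkowski sum: add the centers, collect all generators. -/
def minkSum (X Y : Zonotope E) : Zonotope E where
  center := X.center + Y.center
  p := X.p + Y.p
  gen := Fin.append X.gen Y.gen

end Zonotope

/-- A center together with generators, each of which carries a product (a multiset) of
indeterminates from `σ` with values in `[-1, 1]`. Zonotopes with named indeterminates, matrix
zonotopes (`E = Mat3`) and rotatotopes (`E = Vec3`) are of this form. -/
structure Tope (σ E : Type) where
  center : E
  gens : List (E × Multiset σ)

namespace Tope

variable {σ τ E F : Type} [AddCommGroup E] [Module ℝ E]

/-- Evaluate the indeterminates to which `val` gives a value: multiply each generator by the values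
of its evaluated factors and remove those factors; generators without a remaining indeterminate are
added to the center. -/
def slice (val : σ → Option ℝ) (Z : Tope σ E) : Tope σ E :=
  let gs := Z.gens.map (fun g =>
    ((g.2.filterMap val).prod • g.1, g.2.filter (fun s => val s = none)))
  { center := Z.center + ((gs.filter (fun g => g.2.card = 0)).map Prod.fst).sum
    gens := gs.filter (fun g => g.2.card ≠ 0) }

/-- Reshape the center by `fc` and the generators by `fg`, and rename the indeterminates. -/
def reshape (fc fg : E → F) (r : σ → τ) (Z : Tope σ E) : Tope τ F where
  center := fc Z.center
  gens := Z.gens.map (fun g => (fg g.1, g.2.map r))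

/-- Minkowski sum: add the centers, collect all generators with their indeterminates. -/
def add (V W : Tope σ E) : Tope σ E where
  center := V.center + W.center
  gens := V.gens ++ W.gens

/-- A matrix zonotope times a zonotope or rotatotope: the generators are `X gⁱ`, `Gʲ x` and
`Gʲ gⁱ`, each with the product of the indeterminates of its factors. -/
def mul (M : Tope σ Mat3) (Z : Tope σ Vec3) : Tope σ Vec3 where
  center := M.center.mulVec Z.center
  gens :=
    Z.gens.map (fun g => (M.center.mulVec g.1, g.2)) ++
    M.gens.map (fun G => (G.1.mulVec Z.center, G.2)) ++
    M.gens.flatMap (fun G => Z.gens.map (fun g => (G.1.mulVec g.1, g.2 + G.2)))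

/-- The zonotope with the same center and generators, in which each product of indeterminates is
replaced by a single new coefficient in `[-1, 1]`. -/
def enclosure (Z : Tope σ E) : Zonotope E where
  center := Z.center
  p := Z.gens.length
  gen := fun j => (Z.gens.get j).1

end Tope

/-! ### Joint reachable sets -/

/-- Indeterminates of a zonotope of a joint reachable set: those of the generators sliceable by the
velocity and by the acceleration parameter, and those of the remaining generators. -/
inductive JSym : Type
  | v : JSym
  | a : JSym
  | e (j : ℕ) : JSym

/-- A zonotope in `ℝ² × K_i`, with coordinates (cosine, sine, velocity parameter, acceleration
parameter), two of whose generators are singled out. -/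
structure JRSZonotope where
  center : Fin 4 → ℝ
  gv : Fin 4 → ℝ
  ga : Fin 4 → ℝ
  p : ℕ
  g : Fin p → Fin 4 → ℝ

namespace JRSZonotope

/-- The points of the zonotope. -/
def toSet (Z : JRSZonotope) : Set (Fin 4 → ℝ) :=
  {y | ∃ lv ∈ Set.Icc (-1 : ℝ) 1, ∃ la ∈ Set.Icc (-1 : ℝ) 1, ∃ β : Fin Z.p → ℝ,
    (∀ j, β j ∈ Set.Icc (-1 : ℝ) 1) ∧
      y = Z.center + lv • Z.gv + la • Z.ga + ∑ j, β j • Z.g j}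

/-- The zonotope with its indeterminates. -/
def toTope (Z : JRSZonotope) : Tope JSym (Fin 4 → ℝ) where
  center := Z.center
  gens := (Z.gv, {JSym.v}) :: (Z.ga, {JSym.a}) ::
    List.ofFn (fun j : Fin Z.p => (Z.g j, {JSym.e j}))

end JRSZonotope

namespace PlanSpec

variable {n : ℕ}

/-- The part of the joint reachable set of joint `i` that belongs to the `s`-th time step: all
`(cos q_i(t;k), sin q_i(t;k), k)` with `k ∈ K_i` and `t ∈ [s Δt, (s+1) Δt]`. -/
def jrs (P : PlanSpec n) (arm : Arm n) (i : Fin n) (s : Fin P.N) : Set (Fin 4 → ℝ) :=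
  {y | ∃ kv ∈ P.Kv i, ∃ ka ∈ P.Ka arm i,
    ∃ t ∈ Set.Icc ((s : ℕ) * P.dt) (((s : ℕ) + 1) * P.dt),
      y = ![Real.cos (P.q kv ka t), Real.sin (P.q kv ka t), kv, ka]}

/-- `J` is a zonotope representation of the joint reachable sets: `J i s` overapproximates the
reachable set of joint `i` over the `s`-th time step; it is centered at the center of the parameter
ranges, `gv` is its only generator with a nonzero velocity parameter coordinate and `ga` its only
generator with a nonzero acceleration parameter coordinate, these coordinates being the half-widths
of the parameter ranges. -/
structure IsJRS (P : PlanSpec n) (arm : Arm n) (J : Fin n → Fin P.N → JRSZonotope) : Prop where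
  overapprox : ∀ i s, P.jrs arm i s ⊆ (J i s).toSet
  center_kv : ∀ i s, (J i s).center 2 = P.kvc i
  center_ka : ∀ i s, (J i s).center 3 = P.kac i
  gv_kv : ∀ i s, (J i s).gv 2 = P.dkv i
  gv_ka : ∀ i s, (J i s).gv 3 = 0
  ga_kv : ∀ i s, (J i s).ga 2 = 0
  ga_ka : ∀ i s, (J i s).ga 3 = P.dka i
  g_kv : ∀ i s j, (J i s).g j 2 = 0
  g_ka : ∀ i s j, (J i s).g j 3 = 0

end PlanSpec

/-! ### Reachable set of the arm -/

/-- Indeterminates of the rotatotopes of the arm: those of the joint reachable sets and those of the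
zonotopes that enclose the link volumes. -/
inductive ArmSym (n : ℕ) : Type
  | joint (i : Fin n) (s : JSym) : ArmSym n
  | link (i : Fin n) (j : ℕ) : ArmSym n

/-- Whether an indeterminate is that of the generator of some joint that is sliceable by the
acceleration parameter. -/
def ArmSym.isKa {n : ℕ} : ArmSym n → Bool
  | .joint _ .a => true
  | _ => false

/-- A generator is fully sliceable by `ka` if all its indeterminates are evaluated by `ka`. -/
def fullySliceable {n : ℕ} (g : Vec3 × Multiset (ArmSym n)) : Prop := ∀ s ∈ g.2, s.isKa = true

instance {n : ℕ} : DecidablePred (fullySliceable (n := n)) := fun g =>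
  inferInstanceAs (Decidable (∀ s ∈ g.2, s.isKa = true))

/-- A zonotope of a joint reachable set, sliced by the initial joint velocity `v`. -/
def sliceKv {n : ℕ} (P : PlanSpec n) (i : Fin n) (v : ℝ) (Z : JRSZonotope) :
    Tope JSym (Fin 4 → ℝ) :=
  Z.toTope.slice (fun s => match s with
    | .v => some ((v - P.kvc i) / P.dkv i)
    | _ => none)

/-- The matrix zonotope of the rotations of joint `i`, from the sliced joint zonotope and the
initial joint angle `θ`. -/
def makeMatZono {n : ℕ} (arm : Arm n) (i : Fin n) (θ : ℝ) (Z : Tope JSym (Fin 4 → ℝ)) :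
    Tope (ArmSym n) Mat3 :=
  Z.reshape
    (fun y => arm.R i θ * (axisLin (arm.axis i) (y 0) (y 1) +
      Matrix.vecMulVec (arm.axis i) (arm.axis i)))
    (fun y => arm.R i θ * axisLin (arm.axis i) (y 0) (y 1))
    (ArmSym.joint i)

/-- A point, as a zonotope without generators. -/
def pointTope {n : ℕ} (x : Vec3) : Tope (ArmSym n) Vec3 := ⟨x, []⟩

/-- The zonotope that encloses the volume of link `i`, with its indeterminates. -/
def linkTope {n : ℕ} (i : Fin n) (Z : Zonotope Vec3) : Tope (ArmSym n) Vec3 where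
  center := Z.center
  gens := List.ofFn (fun j : Fin Z.p => (Z.gen j, {ArmSym.link i j}))

/-- `(∏_{m ≤ j} M_m) Z`, multiplied out from the right. -/
def prodAct {n : ℕ} (M : Fin n → Tope (ArmSym n) Mat3) (j : Fin n) (Z : Tope (ArmSym n) Vec3) :
    Tope (ArmSym n) Vec3 :=
  ((List.finRange n).filter (fun m => m ≤ j)).foldr (fun m W => (M m).mul W) Z

/-- The rotatotope `V_i = ⨁_{j < i} (∏_{m ≤ j} M_m) {l_j} ⊕ (∏_{m ≤ i} M_m) L_i`. -/
def stack {n : ℕ} (arm : Arm n) (Lz : Fin n → Zonotope Vec3) (M : Fin n → Tope (ArmSym n) Mat3)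
    (i : Fin n) : Tope (ArmSym n) Vec3 :=
  ((List.finRange n).filter (fun j => j < i)).foldr
    (fun j W => (prodAct M j (pointTope (arm.disp j))).add W)
    (prodAct M i (linkTope i (Lz i)))

/-- The rotatotope of link `i` over the `s`-th time step, composed from the joint zonotopes `J`,
the link zonotopes `Lz`, the initial joint angles `q0` and the initial joint velocities `dq0`. -/
def composeRS {n : ℕ} (arm : Arm n) (P : PlanSpec n) (J : Fin n → Fin P.N → JRSZonotope)
    (Lz : Fin n → Zonotope Vec3) (q0 dq0 : Fin n → ℝ) (i : Fin n) (s : Fin P.N) :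
    Tope (ArmSym n) Vec3 :=
  stack arm Lz (fun m => makeMatZono arm m (q0 m) (sliceKv P m (dq0 m) (J m s))) i

/-- The part of a rotatotope with the fully sliceable generators, and the center. -/
def slcPart {n : ℕ} (V : Tope (ArmSym n) Vec3) : Tope (ArmSym n) Vec3 where
  center := V.center
  gens := V.gens.filter (fun g => fullySliceable g)

/-- The part of a rotatotope with all other generators, centered at `0`. -/
def bufPart {n : ℕ} (V : Tope (ArmSym n) Vec3) : Tope (ArmSym n) Vec3 where
  center := 0
  gens := V.gens.filter (fun g => ¬ fullySliceable g)

/-- Slice by the acceleration parameters `ka`; all generators of a `slcPart` get fully sliced, so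
that the point which is left is the center. -/
def evalKa {n : ℕ} (P : PlanSpec n) (V : Tope (ArmSym n) Vec3) (ka : Fin n → ℝ) : Vec3 :=
  (V.slice (fun s => match s with
    | .joint i .a => some ((ka i - P.kac i) / P.dka i)
    | _ => none)).center

/-! ### Constraints -/

/-- Data of finitely many half-spaces `(A z - b)_r ≤ 0`. -/
structure Halfspaces where
  m : ℕ
  A : Matrix (Fin m) (Fin 3) ℝ
  b : Fin m → ℝ

/-- `H` is a half-space representation of `X`: `A z - b ≤ 0` elementwise iff `z ∈ X`. -/
def Halfspaces.Represents (H : Halfspaces) (X : Set Vec3) : Prop :=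
  ∀ z : Vec3, (∀ r, (H.A.mulVec z - H.b) r ≤ 0) ↔ z ∈ X

/-- The obstacle zonotope buffered by the generators of `V` that are not fully sliceable. -/
def bufferedObstacle {n : ℕ} (V : Tope (ArmSym n) Vec3) (Oz : Zonotope Vec3) : Zonotope Vec3 :=
  Oz.minkSum (bufPart V).enclosure

/-- The obstacle constraint `-max (A x - b)` at `x = eval(V_slc, ka)`, for one link, one time step
and one obstacle; `H` is `(A, b)`. -/
def hobs {n : ℕ} (P : PlanSpec n) (V : Tope (ArmSym n) Vec3) (H : Halfspaces)
    (ka : Fin n → ℝ) : ℝ :=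
  -(⨆ r : Fin H.m, (H.A.mulVec (evalKa P (slcPart V) ka) - H.b) r)

/-- The times at which position and speed of a joint can be extremal over `[0, tf]`: start, zero of
the velocity during the acceleration phase (moved to the nearest end point of the phase if it lies
outside), end of the acceleration phase, end of the plan. -/
def extremalTimes {n : ℕ} (P : PlanSpec n) (kv ka : ℝ) : Fin 4 → ℝ :=
  ![0, max 0 (min P.tplan (-kv / ka)), P.tplan, P.tf]

/-- The joint limit constraint: the largest violation of a position or speed limit by any joint at
any of its extremal times. -/
def hlim {n : ℕ} (arm : Arm n) (P : PlanSpec n) (q0 dq0 ka : Fin n → ℝ) : ℝ :=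
  ⨆ i : Fin n, ⨆ c : Fin 4,
    let t := extremalTimes P (dq0 i) (ka i) c
    max (max (arm.qmin i - (q0 i + P.q (dq0 i) (ka i) t))
      ((q0 i + P.q (dq0 i) (ka i) t) - arm.qmax i)) (|P.dq (dq0 i) (ka i) t| - arm.dqmax i)

/-- Feasibility of `ka` for the trajectory optimization program: `ka` is an admissible acceleration
parameter and satisfies the constraint `hobs < 0` for all joints, times and obstacles (here `V i s`
are the rotatotopes of the arm and `H i s o` the half-space data), and `hlim < 0`. -/
structure Feasible {n m : ℕ} (arm : Arm n) (P : PlanSpec n) (q0 dq0 : Fin n → ℝ)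
    (V : Fin n → Fin P.N → Tope (ArmSym n) Vec3) (H : Fin n → Fin P.N → Fin m → Halfspaces)
    (ka : Fin n → ℝ) : Prop where
  mem : ∀ i, ka i ∈ P.Ka arm i
  obs : ∀ i, ∀ t ∈ Set.Icc 0 P.tf, ∀ o, hobs P (V i (P.step t)) (H i (P.step t) o) ka < 0
  lim : hlim arm P q0 dq0 ka < 0

end

/-! The rotatotope of a link is an algebraic expression in indeterminates with values in `[-1, 1]`.
`Tope.eval` substitutes values for all of them, and every operation of the construction commutes
with this substitution: `Tope.eval_slice`, `Tope.eval_mul`, `eval_prodAct`, `eval_stack`.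

Fix a time `t` and a feasible `ka`. The point `(cos q, sin q, kv, ka)` of each joint lies in the
joint zonotope, and its last two coordinates force the coefficients of the two distinguished
generators to be exactly the values used for slicing (`JRSZonotope.exists_coeff`). With these
coefficients, and those of a point of the link volume, the rotatotope evaluates to the position of
that point in the workspace (`exists_eval_composeRS`): the matrix zonotopes evaluate to the
true rotations because rotations about one axis add up (`axisRot_mul_axisRot`).

Splitting the generators writes this position as `x + w`, where `x` is the fully sliced point and
`w` belongs to the buffer, since a product of numbers in `[-1, 1]` lies in `[-1, 1]`. If the
position were in an obstacle, then `x = (x + w) + (-w)` would be in the buffered obstacle, as the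
buffer is symmetric; but `hobs < 0` says that `x` violates one of its defining half-spaces.

For the joint limits, the trajectory is quadratic up to `tplan` and monotone afterwards, so position
and speed are bounded by their values at the extremal times. A representation of the joint
reachable sets exists because the box `[-1, 1]² × Kv × [kac - dka, kac + dka]` is one. -/

/-! ### Evaluation of indeterminates -/

namespace Tope

variable {σ τ E F : Type} [AddCommGroup E] [Module ℝ E] [AddCommGroup F] [Module ℝ F]

/-- The sum of a list of generators, each scaled by the value of its product of indeterminates. -/
noncomputable def evalGens (β : σ → ℝ) (l : List (E × Multiset σ)) : E :=
  (l.map (fun g => (g.2.map β).prod • g.1)).sum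

/-- The point of a tope at given values of all its indeterminates. -/
noncomputable def eval (β : σ → ℝ) (Z : Tope σ E) : E := Z.center + evalGens β Z.gens

@[simp] lemma evalGens_nil (β : σ → ℝ) : evalGens β ([] : List (E × Multiset σ)) = 0 := rfl

@[simp] lemma evalGens_cons (β : σ → ℝ) (g : E × Multiset σ) (l : List (E × Multiset σ)) :
    evalGens β (g :: l) = (g.2.map β).prod • g.1 + evalGens β l := rfl

@[simp] lemma evalGens_append (β : σ → ℝ) (l l' : List (E × Multiset σ)) :
    evalGens β (l ++ l') = evalGens β l + evalGens β l' := by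
  simp [evalGens]

lemma evalGens_filter_add (β : σ → ℝ) (p : E × Multiset σ → Prop) [DecidablePred p]
    (l : List (E × Multiset σ)) :
    evalGens β (l.filter (fun g => p g)) + evalGens β (l.filter (fun g => ¬ p g)) =
      evalGens β l := by
  induction l with
  | nil => simp
  | cons g l ih =>
    rw [evalGens_cons, ← ih]
    by_cases h : p g
    · simp [h, add_assoc]
    · simp [h, add_left_comm]

lemma evalGens_ofFn_singleton {p : ℕ} (β : σ → ℝ) (g : Fin p → E) (s : Fin p → σ) :
    evalGens β (List.ofFn (fun j => (g j, ({s j} : Multiset σ)))) = ∑ j, β (s j) • g j := by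
  simp [evalGens, List.map_ofFn, List.sum_ofFn]

lemma evalGens_map_linear (β : τ → ℝ) (f : E →ₗ[ℝ] F) (r : σ → τ) (l : List (E × Multiset σ)) :
    evalGens β (l.map (fun g => (f g.1, g.2.map r))) = f (evalGens (fun s => β (r s)) l) := by
  induction l with
  | nil => simp
  | cons g l ih => simp [ih]

@[simp] lemma eval_add (β : σ → ℝ) (V W : Tope σ E) :
    (V.add W).eval β = V.eval β + W.eval β := by
  simp only [eval, add, evalGens_append]
  abel

lemma prod_filterMap_mul_prod_filter {β : σ → ℝ} {val : σ → Option ℝ}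
    (h : ∀ s x, val s = some x → β s = x) (m : Multiset σ) :
    (m.filterMap val).prod * ((m.filter (fun s => val s = none)).map β).prod =
      (m.map β).prod := by
  induction m using Multiset.induction_on with
  | empty => simp
  | cons s m ih =>
    rw [Multiset.map_cons, Multiset.prod_cons, ← ih]
    cases hs : val s with
    | none => simp [hs, mul_left_comm]
    | some x => simp [hs, h s x hs, mul_assoc]

/-- Slicing does not change the value at an assignment that extends the sliced values. -/
lemma eval_slice {β : σ → ℝ} {val : σ → Option ℝ} (h : ∀ s x, val s = some x → β s = x)
    (Z : Tope σ E) : (Z.slice val).eval β = Z.eval β := by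
  have key : ∀ l : List (E × Multiset σ),
      ((l.filter (fun g => g.2.card = 0)).map Prod.fst).sum +
        evalGens β (l.filter (fun g => g.2.card ≠ 0)) = evalGens β l := by
    intro l
    induction l with
    | nil => simp
    | cons g l ih =>
      rw [evalGens_cons, ← ih]
      by_cases hg : g.2 = 0
      · simp [hg, add_assoc]
      · simp [hg, add_left_comm]
  have hmap : evalGens β (Z.gens.map (fun g =>
      ((g.2.filterMap val).prod • g.1, g.2.filter (fun s => val s = none)))) =
      evalGens β Z.gens := by
    simp only [evalGens, List.map_map]
    congr 1
    refine List.map_congr_left fun g _ => ?_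
    simp only [Function.comp, smul_smul]
    rw [mul_comm, prod_filterMap_mul_prod_filter h]
  simp only [eval, slice, add_assoc]
  rw [key, hmap]

lemma evalGens_mulVec_right (β : σ → ℝ) (A : Mat3) (l : List (Vec3 × Multiset σ)) :
    evalGens β (l.map (fun g => (A.mulVec g.1, g.2))) = A.mulVec (evalGens β l) := by
  simpa using evalGens_map_linear β A.mulVecLin id l

lemma evalGens_mulVec_left (β : σ → ℝ) (x : Vec3) (l : List (Mat3 × Multiset σ)) :
    evalGens β (l.map (fun G => (G.1.mulVec x, G.2))) = (evalGens β l).mulVec x := by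
  induction l with
  | nil => simp
  | cons G l ih => simp [ih, Matrix.add_mulVec, Matrix.smul_mulVec]

lemma evalGens_flatMap_mulVec (β : σ → ℝ) (l : List (Mat3 × Multiset σ))
    (l' : List (Vec3 × Multiset σ)) :
    evalGens β (l.flatMap (fun G => l'.map (fun g => (G.1.mulVec g.1, g.2 + G.2)))) =
      (evalGens β l).mulVec (evalGens β l') := by
  induction l with
  | nil => simp
  | cons G l ih =>
    have h : evalGens β (l'.map (fun g => (G.1.mulVec g.1, g.2 + G.2))) =
        (G.2.map β).prod • G.1.mulVec (evalGens β l') := by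
      clear ih
      induction l' with
      | nil => simp
      | cons g l' ih =>
        simp [ih, Matrix.mulVec_add, Matrix.mulVec_smul, smul_smul, mul_comm]
    simp [ih, h, Matrix.add_mulVec, Matrix.smul_mulVec]

lemma eval_mul (β : σ → ℝ) (M : Tope σ Mat3) (Z : Tope σ Vec3) :
    (M.mul Z).eval β = (M.eval β).mulVec (Z.eval β) := by
  simp only [eval, mul, evalGens_append, evalGens_mulVec_right, evalGens_mulVec_left,
    evalGens_flatMap_mulVec, Matrix.add_mulVec, Matrix.mulVec_add]
  abel

/-- The enclosure contains all values of a tope, since a product of numbers in `[-1, 1]` is again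
in `[-1, 1]`. -/
lemma eval_mem_enclosure {β : σ → ℝ} (hβ : ∀ s, |β s| ≤ 1) (Z : Tope σ E) :
    Z.eval β ∈ Z.enclosure.toSet := by
  have hprod : ∀ m : Multiset σ, |(m.map β).prod| ≤ 1 := by
    intro m
    induction m using Multiset.induction_on with
    | empty => simp
    | cons s m ih =>
      rw [Multiset.map_cons, Multiset.prod_cons, abs_mul]
      exact mul_le_one₀ (hβ s) (abs_nonneg _) ih
  refine ⟨fun j => ((Z.gens.get j).2.map β).prod, fun j => abs_le.1 (hprod _), ?_⟩
  change Z.center + _ = Z.center + _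
  congr 1
  change (Z.gens.map _).sum = ∑ j : Fin Z.gens.length, _
  rw [← List.sum_ofFn]
  congr 1
  conv_lhs => rw [← List.ofFn_get Z.gens, List.map_ofFn]
  rfl

end Tope

/-! ### Zonotopes -/

namespace Zonotope

variable {E : Type} [AddCommGroup E] [Module ℝ E]

lemma add_mem_minkSum {X Y : Zonotope E} {x y : E} (hx : x ∈ X.toSet) (hy : y ∈ Y.toSet) :
    x + y ∈ (X.minkSum Y).toSet := by
  obtain ⟨β, hβ, rfl⟩ := hx
  obtain ⟨γ, hγ, rfl⟩ := hy
  refine ⟨Fin.append β γ, fun j => ?_, ?_⟩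
  · refine Fin.addCases (fun i => ?_) (fun i => ?_) j
    · simpa using hβ i
    · simpa using hγ i
  · change _ = X.center + Y.center + ∑ j : Fin (X.p + Y.p), _ • Fin.append X.gen Y.gen j
    rw [Fin.sum_univ_add]
    simp only [Fin.append_left, Fin.append_right]
    abel

lemma neg_mem_of_center_eq_zero {X : Zonotope E} (h : X.center = 0) {x : E}
    (hx : x ∈ X.toSet) : -x ∈ X.toSet := by
  obtain ⟨β, hβ, rfl⟩ := hx
  refine ⟨fun j => -β j, fun j => ⟨?_, ?_⟩, ?_⟩
  · linarith [(hβ j).2]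
  · linarith [(hβ j).1]
  · simp [h]

end Zonotope

/-! ### Rotations about a common axis -/

lemma axisRot_mul_axisRot {a : Vec3} (ha : a ⬝ᵥ a = 1) (θ φ : ℝ) :
    axisRot a θ * axisRot a φ = axisRot a (θ + φ) := by
  have h : a 0 * a 0 + a 1 * a 1 + a 2 * a 2 = 1 := by
    simpa [dotProduct, Fin.sum_univ_three] using ha
  have hP : Matrix.vecMulVec a a * Matrix.vecMulVec a a = Matrix.vecMulVec a a := by
    rw [Matrix.vecMulVec_mul_vecMulVec, ha]
    simp
  have hPK : Matrix.vecMulVec a a * crossMat a = 0 := by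
    ext i j
    fin_cases i <;> fin_cases j <;>
      simp [Matrix.mul_apply, Fin.sum_univ_three, Matrix.vecMulVec_apply, crossMat] <;> ring
  have hKP : crossMat a * Matrix.vecMulVec a a = 0 := by
    ext i j
    fin_cases i <;> fin_cases j <;>
      simp [Matrix.mul_apply, Fin.sum_univ_three, Matrix.vecMulVec_apply, crossMat] <;> ring
  have hKK : crossMat a * crossMat a = Matrix.vecMulVec a a - 1 := by
    ext i j
    fin_cases i <;> fin_cases j <;>
      simp [Matrix.mul_apply, Fin.sum_univ_three, Matrix.vecMulVec_apply, crossMat] <;>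
      linarith
  simp only [axisRot, axisLin, Real.cos_add, Real.sin_add, mul_add, add_mul, mul_sub, sub_mul,
    smul_mul_assoc, mul_smul_comm, hP, hPK, hKP, hKK, mul_one, one_mul, smul_add, smul_sub,
    smul_smul, smul_zero]
  module

lemma Arm.R_mul_axisRot {n : ℕ} (arm : Arm n) (i : Fin n) (θ φ : ℝ) :
    arm.R i θ * axisRot (arm.axis i) φ = arm.R i (θ + φ) := by
  rw [Arm.R, Arm.R, Matrix.mul_assoc, axisRot_mul_axisRot (arm.axis_unit i)]

/-- `axisLin` as a linear map of the (cosine, sine) part of a point of `ℝ⁴`, multiplied from the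
left by a fixed matrix. -/
noncomputable def axisLinMap (A : Mat3) (a : Vec3) : (Fin 4 → ℝ) →ₗ[ℝ] Mat3 where
  toFun y := A * axisLin a (y 0) (y 1)
  map_add' y z := by
    rw [← mul_add]
    congr 1
    simp only [axisLin, Pi.add_apply]
    module
  map_smul' r y := by
    rw [RingHom.id_apply, ← mul_smul_comm]
    congr 1
    simp only [axisLin, Pi.smul_apply, smul_eq_mul]
    module

/-! ### Evaluation of the rotatotopes of the arm -/

lemma eval_makeMatZono {n : ℕ} (arm : Arm n) (i : Fin n) (θ : ℝ) (Z : Tope JSym (Fin 4 → ℝ))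
    (β : ArmSym n → ℝ) :
    (makeMatZono arm i θ Z).eval β =
      arm.R i θ * (axisLin (arm.axis i) (Z.eval (fun s => β (.joint i s)) 0)
        (Z.eval (fun s => β (.joint i s)) 1) + Matrix.vecMulVec (arm.axis i) (arm.axis i)) := by
  have h := Tope.evalGens_map_linear β (axisLinMap (arm.R i θ) (arm.axis i))
    (ArmSym.joint i) Z.gens
  have hadd := (axisLinMap (arm.R i θ) (arm.axis i)).map_add Z.center
    (Tope.evalGens (fun s => β (.joint i s)) Z.gens)
  simp only [axisLinMap, LinearMap.coe_mk, AddHom.coe_mk] at h hadd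
  simp only [Tope.eval, makeMatZono, Tope.reshape]
  rw [h, mul_add, mul_add, hadd]
  abel

lemma eval_prodAct {n : ℕ} (M : Fin n → Tope (ArmSym n) Mat3) (j : Fin n)
    (Z : Tope (ArmSym n) Vec3) (β : ArmSym n → ℝ) :
    (prodAct M j Z).eval β =
      ((((List.finRange n).filter (fun m => m ≤ j)).map (fun m => (M m).eval β)).prod).mulVec
        (Z.eval β) := by
  unfold prodAct
  induction (List.finRange n).filter (fun m => m ≤ j) with
  | nil => simp
  | cons m l ih => simp [Tope.eval_mul, ih, Matrix.mulVec_mulVec]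

lemma eval_stack {n : ℕ} (arm : Arm n) (Lz : Fin n → Zonotope Vec3)
    (M : Fin n → Tope (ArmSym n) Mat3) (q : Fin n → ℝ) (β : ArmSym n → ℝ)
    (hM : ∀ m, (M m).eval β = arm.R m (q m)) (i : Fin n) :
    (stack arm Lz M i).eval β =
      ∑ j ∈ Finset.univ.filter (fun j => j < i), (arm.prodR q j).mulVec (arm.disp j) +
        (arm.prodR q i).mulVec ((linkTope i (Lz i)).eval β) := by
  have hact : ∀ (j : Fin n) (Z : Tope (ArmSym n) Vec3),
      (prodAct M j Z).eval β = (arm.prodR q j).mulVec (Z.eval β) := by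
    intro j Z
    rw [eval_prodAct, Arm.prodR]
    simp only [hM]
  have hsum : ∀ f : Fin n → Vec3, ∑ j ∈ Finset.univ.filter (fun j => j < i), f j =
      (((List.finRange n).filter (fun j => j < i)).map f).sum := by
    intro f
    rw [← List.sum_toFinset _ ((List.nodup_finRange n).filter _)]
    congr 1
    ext j
    simp
  rw [hsum, stack]
  induction (List.finRange n).filter (fun j => j < i) with
  | nil => simp [hact]
  | cons j l ih =>
    rw [List.foldr_cons, Tope.eval_add, ih, hact, List.map_cons, List.sum_cons, add_assoc]
    simp [Tope.eval, pointTope]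

/-! ### Joint reachable sets -/

lemma JRSZonotope.eval_toTope (Z : JRSZonotope) (β : JSym → ℝ) :
    Z.toTope.eval β =
      Z.center + β .v • Z.gv + β .a • Z.ga + ∑ j : Fin Z.p, β (.e j) • Z.g j := by
  simp only [Tope.eval, JRSZonotope.toTope, Tope.evalGens_cons]
  rw [Tope.evalGens_ofFn_singleton β Z.g (fun j => JSym.e j)]
  simp [add_assoc]

namespace PlanSpec

variable {n : ℕ}

lemma dt_pos (P : PlanSpec n) : 0 < P.dt :=
  div_pos (P.tplan_pos.trans P.tplan_lt) (Nat.cast_pos.2 P.N_pos)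

lemma mem_step (P : PlanSpec n) {t : ℝ} (ht : t ∈ Set.Icc 0 P.tf) :
    t ∈ Set.Icc (((P.step t : Fin P.N) : ℕ) * P.dt) ((((P.step t : Fin P.N) : ℕ) + 1) * P.dt) := by
  have hdt := P.dt_pos
  have h0 : 0 ≤ t / P.dt := div_nonneg ht.1 hdt.le
  have hval : ((P.step t : Fin P.N) : ℕ) = min ⌊t / P.dt⌋₊ (P.N - 1) := rfl
  rw [hval]
  refine ⟨?_, ?_⟩
  · rw [← le_div_iff₀ hdt]
    refine le_trans ?_ (Nat.floor_le h0)
    exact_mod_cast min_le_left _ _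
  · rw [← div_le_iff₀ hdt]
    rcases le_total ⌊t / P.dt⌋₊ (P.N - 1) with h | h
    · rw [min_eq_left h]
      exact (Nat.lt_floor_add_one _).le
    · rw [min_eq_right h, Nat.cast_sub P.N_pos, Nat.cast_one, sub_add_cancel,
        div_le_iff₀ hdt, dt, mul_div_cancel₀ _ (Nat.cast_ne_zero.2 P.N_pos.ne')]
      exact ht.2

/-- The box `[-1, 1]² × Kv × [kac - dka, kac + dka]` represents the joint reachable sets. -/
lemma exists_isJRS (P : PlanSpec n) (arm : Arm n) :
    ∃ J : Fin n → Fin P.N → JRSZonotope, P.IsJRS arm J := by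
  refine ⟨fun i _ =>
    { center := ![0, 0, P.kvc i, P.kac i]
      gv := ![0, 0, P.dkv i, 0]
      ga := ![0, 0, 0, P.dka i]
      p := 2
      g := ![![1, 0, 0, 0], ![0, 1, 0, 0]] }, ?_⟩
  have unit : ∀ {x c d : ℝ}, 0 < d → c - d ≤ x → x ≤ c + d →
      (x - c) / d ∈ Set.Icc (-1 : ℝ) 1 := by
    intro x c d hd h1 h2
    rw [Set.mem_Icc, le_div_iff₀ hd, div_le_iff₀ hd]
    constructor <;> linarith
  constructor
  · rintro i s _ ⟨kv, hkv, ka, hka, t, -, rfl⟩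
    have hv := P.dkv_pos i
    have ha := P.dka_pos i
    refine ⟨(kv - P.kvc i) / P.dkv i, unit hv hkv.1 hkv.2, (ka - P.kac i) / P.dka i,
      unit ha ((le_max_right _ _).trans hka.1) (hka.2.trans (min_le_right _ _)),
      ![Real.cos (P.q kv ka t), Real.sin (P.q kv ka t)], ?_, ?_⟩
    · intro j
      fin_cases j
      · exact ⟨Real.neg_one_le_cos _, Real.cos_le_one _⟩
      · exact ⟨Real.neg_one_le_sin _, Real.sin_le_one _⟩
    · ext j
      fin_cases j <;> simp [Fin.sum_univ_two, hv.ne', ha.ne']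
  all_goals intros
  all_goals first | rfl | skip
  all_goals rename_i j; fin_cases j <;> rfl

end PlanSpec

/-- The coefficients of a point of a joint zonotope; those of the two distinguished generators are
determined by the parameter coordinates of the point. -/
lemma PlanSpec.IsJRS.exists_coeff {n : ℕ} {P : PlanSpec n} {arm : Arm n}
    {J : Fin n → Fin P.N → JRSZonotope} (hJ : P.IsJRS arm J) (i : Fin n) (s : Fin P.N)
    {y : Fin 4 → ℝ} (hy : y ∈ (J i s).toSet) :
    ∃ β : JSym → ℝ, (∀ x, |β x| ≤ 1) ∧ β .v = (y 2 - P.kvc i) / P.dkv i ∧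
      β .a = (y 3 - P.kac i) / P.dka i ∧ (J i s).toTope.eval β = y := by
  obtain ⟨lv, hlv, la, hla, γ, hγ, rfl⟩ := hy
  refine ⟨fun x => match x with
    | .v => lv
    | .a => la
    | .e j => if h : j < (J i s).p then γ ⟨j, h⟩ else 0, ?_, ?_, ?_, ?_⟩
  · rintro (_ | _ | j)
    · exact abs_le.2 hlv
    · exact abs_le.2 hla
    · by_cases h : j < (J i s).p
      · simpa [h] using abs_le.2 (hγ ⟨j, h⟩)
      · simp [h]
  · have := (P.dkv_pos i).ne'
    simp [hJ.center_kv, hJ.gv_kv, hJ.ga_kv, hJ.g_kv, this]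
  · have := (P.dka_pos i).ne'
    simp [hJ.center_ka, hJ.gv_ka, hJ.ga_ka, hJ.g_ka, this]
  · rw [JRSZonotope.eval_toTope]
    simp

/-! ### Occupancy and obstacles -/

/-- Every point of the forward occupancy of link `i` is a value of its rotatotope, at an assignment
that agrees with slicing by `ka`. -/
lemma exists_eval_composeRS {n : ℕ} {arm : Arm n} {P : PlanSpec n}
    {J : Fin n → Fin P.N → JRSZonotope} (hJ : P.IsJRS arm J) {Lz : Fin n → Zonotope Vec3}
    (hL : ∀ i, arm.vol i ⊆ (Lz i).toSet) {q0 dq0 ka : Fin n → ℝ} (hdq : ∀ i, dq0 i ∈ P.Kv i)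
    (hka : ∀ i, ka i ∈ P.Ka arm i) {t : ℝ} (ht : t ∈ Set.Icc 0 P.tf) (i : Fin n) {z : Vec3}
    (hz : z ∈ arm.FOlink i (fun i => q0 i + P.q (dq0 i) (ka i) t)) :
    ∃ β : ArmSym n → ℝ, (∀ s, |β s| ≤ 1) ∧
      (∀ m, β (.joint m .a) = (ka m - P.kac m) / P.dka m) ∧
      (composeRS arm P J Lz q0 dq0 i (P.step t)).eval β = z := by
  obtain ⟨_, rfl, _, ⟨l, hl, rfl⟩, rfl⟩ := hz
  obtain ⟨γ, hγ, rfl⟩ := hL i hl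
  have hmem : ∀ m, ![Real.cos (P.q (dq0 m) (ka m) t), Real.sin (P.q (dq0 m) (ka m) t),
      dq0 m, ka m] ∈ (J m (P.step t)).toSet := fun m =>
    hJ.overapprox m _ ⟨dq0 m, hdq m, ka m, hka m, t, P.mem_step ht, rfl⟩
  choose α hα hαv hαa hαe using fun m => hJ.exists_coeff m (P.step t) (hmem m)
  -- Only the link indeterminates of link `i` occur in its rotatotope, so the coefficients `γ` can
  -- serve for the indeterminates of every link.
  let β : ArmSym n → ℝ := fun s => match s with
    | .joint m x => α m x
    | .link _ j => if h : j < (Lz i).p then γ ⟨j, h⟩ else 0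
  refine ⟨β, ?_, fun m => by simpa [β] using hαa m, ?_⟩
  · rintro (⟨m, x⟩ | ⟨m, j⟩)
    · exact hα m x
    · by_cases h : j < (Lz i).p
      · simpa [β, h] using abs_le.2 (hγ ⟨j, h⟩)
      · simp [β, h]
  · rw [composeRS, eval_stack arm Lz _ (fun m => q0 m + P.q (dq0 m) (ka m) t) β]
    · congr 2
      simp only [Tope.eval, linkTope]
      rw [Tope.evalGens_ofFn_singleton β (Lz i).gen (fun j => ArmSym.link i j)]
      simp [β]
    · intro m
      rw [eval_makeMatZono, sliceKv, Tope.eval_slice]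
      · change arm.R m (q0 m) * (axisLin _ ((Tope.eval (α m) _ : Fin 4 → ℝ) 0)
          ((Tope.eval (α m) _ : Fin 4 → ℝ) 1) + _) = _
        rw [hαe, ← arm.R_mul_axisRot]
        rfl
      · rintro (_ | _ | j) x hx
        · rw [← Option.some.inj hx]
          exact hαv m
        · cases hx
        · cases hx

/-- Slicing by `ka` reduces the fully sliceable part to its value. -/
lemma evalKa_slcPart {n : ℕ} (P : PlanSpec n) (V : Tope (ArmSym n) Vec3) {ka : Fin n → ℝ}
    {β : ArmSym n → ℝ} (hβ : ∀ m, β (.joint m .a) = (ka m - P.kac m) / P.dka m) :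
    evalKa P (slcPart V) ka = (slcPart V).eval β := by
  unfold evalKa
  rw [← Tope.eval_slice (β := β) (val := fun s => match s with
    | .joint i .a => some ((ka i - P.kac i) / P.dka i)
    | _ => none)]
  · rw [Tope.eval, left_eq_add]
    -- No indeterminate survives slicing, so no generator is left.
    convert Tope.evalGens_nil β
    simp only [Tope.slice, slcPart, List.filter_eq_nil_iff, List.mem_map, List.mem_filter]
    rintro _ ⟨g, ⟨-, hg⟩, rfl⟩
    have hg' : ∀ s ∈ g.2, s.isKa = true := of_decide_eq_true hg
    simp only [ne_eq, decide_not, Bool.not_eq_true', decide_eq_false_iff_not, not_not,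
      Multiset.card_eq_zero, Multiset.filter_eq_nil]
    rintro (⟨m, _ | _ | j⟩ | ⟨m, j⟩) hs
    · simpa [ArmSym.isKa] using hg' _ hs
    · simp
    · simpa [ArmSym.isKa] using hg' _ hs
    · simpa [ArmSym.isKa] using hg' _ hs
  · rintro (⟨m, _ | _ | j⟩ | ⟨m, j⟩) x hx
    · cases hx
    · rw [← Option.some.inj hx]
      exact hβ m
    · cases hx
    · cases hx

/-- If a value of the rotatotope is in the obstacle zonotope, then the fully sliced point is in the
buffered obstacle. -/
lemma evalKa_mem_bufferedObstacle {n : ℕ} (P : PlanSpec n) (V : Tope (ArmSym n) Vec3)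
    {ka : Fin n → ℝ} {β : ArmSym n → ℝ} (hβ : ∀ s, |β s| ≤ 1)
    (hβa : ∀ m, β (.joint m .a) = (ka m - P.kac m) / P.dka m) {Oz : Zonotope Vec3}
    (hV : V.eval β ∈ Oz.toSet) :
    evalKa P (slcPart V) ka ∈ (bufferedObstacle V Oz).toSet := by
  have hsplit : V.eval β = (slcPart V).eval β + (bufPart V).eval β := by
    simp only [Tope.eval, slcPart, bufPart, zero_add, add_assoc]
    rw [Tope.evalGens_filter_add]
  have hbuf : -(bufPart V).eval β ∈ (bufPart V).enclosure.toSet :=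
    Zonotope.neg_mem_of_center_eq_zero rfl (Tope.eval_mem_enclosure hβ _)
  have := Zonotope.add_mem_minkSum hV hbuf
  rwa [hsplit, add_neg_cancel_right, ← evalKa_slcPart P V hβa] at this

lemma notMem_of_hobs_neg {n : ℕ} {P : PlanSpec n} {V : Tope (ArmSym n) Vec3} {H : Halfspaces}
    {ka : Fin n → ℝ} {X : Set Vec3} (hH : H.Represents X) (h : hobs P V H ka < 0) :
    evalKa P (slcPart V) ka ∉ X := by
  intro hx
  have := Real.iSup_nonpos ((hH _).2 hx)
  rw [hobs] at h
  linarith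

/-! ### Joint limits -/

namespace PlanSpec

variable {n : ℕ} (P : PlanSpec n) (kv ka : ℝ)

lemma dq_of_le {t : ℝ} (ht : t ≤ P.tplan) : P.dq kv ka t = kv + ka * t := by
  rcases ht.lt_or_eq with h | rfl
  · simp [dq, h]
  · have := sub_pos.2 P.tplan_lt
    simp [dq, this.ne']

lemma dq_of_ge {t : ℝ} (ht : P.tplan ≤ t) :
    P.dq kv ka t = (kv + ka * P.tplan) / (P.tf - P.tplan) * (P.tf - t) := by
  simp [dq, ht.not_gt]

lemma q_of_le {t : ℝ} (h0 : 0 ≤ t) (ht : t ≤ P.tplan) :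
    P.q kv ka t = kv * t + ka * t ^ 2 / 2 := by
  have h : Set.EqOn (P.dq kv ka) (fun u => kv + ka * u) (Set.uIcc 0 t) := by
    intro u hu
    rw [Set.uIcc_of_le h0] at hu
    exact P.dq_of_le kv ka (hu.2.trans ht)
  rw [q, intervalIntegral.integral_congr h, intervalIntegral.integral_add (by simp)
    (Continuous.intervalIntegrable (by fun_prop) _ _),
    intervalIntegral.integral_const_mul, integral_id]
  simp
  ring

lemma q_of_ge {t : ℝ} (ht : P.tplan ≤ t) :
    P.q kv ka t = P.q kv ka P.tplan + (kv + ka * P.tplan) / (P.tf - P.tplan) *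
      (((P.tf - P.tplan) ^ 2 - (P.tf - t) ^ 2) / 2) := by
  have h1 : Set.EqOn (P.dq kv ka) (fun u => kv + ka * u) (Set.uIcc 0 P.tplan) := by
    intro u hu
    rw [Set.uIcc_of_le P.tplan_pos.le] at hu
    exact P.dq_of_le kv ka hu.2
  have h2 : Set.EqOn (P.dq kv ka)
      (fun u => (kv + ka * P.tplan) / (P.tf - P.tplan) * (P.tf - u)) (Set.uIcc P.tplan t) := by
    intro u hu
    rw [Set.uIcc_of_le ht] at hu
    exact P.dq_of_ge kv ka hu.1
  have i1 : IntervalIntegrable (P.dq kv ka) MeasureTheory.volume 0 P.tplan :=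
    (ContinuousOn.congr (by fun_prop) h1).intervalIntegrable
  have i2 : IntervalIntegrable (P.dq kv ka) MeasureTheory.volume P.tplan t :=
    (ContinuousOn.congr (by fun_prop) h2).intervalIntegrable
  rw [q, ← intervalIntegral.integral_add_adjacent_intervals i1 i2,
    intervalIntegral.integral_congr h2, intervalIntegral.integral_const_mul,
    intervalIntegral.integral_sub (by simp)
      (Continuous.intervalIntegrable (by fun_prop) _ _), integral_id, q]
  simp only [intervalIntegral.integral_const, smul_eq_mul]
  ring

/-- The joint speed is largest at time `0` or `tplan`. -/
lemma exists_abs_dq_le {t : ℝ} (ht : t ∈ Set.Icc 0 P.tf) :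
    ∃ c, |P.dq kv ka t| ≤ |P.dq kv ka (extremalTimes P kv ka c)| := by
  have hp := P.tplan_pos
  rcases le_total t P.tplan with h | h
  · have hmax : |P.dq kv ka t| ≤ max |P.dq kv ka 0| |P.dq kv ka P.tplan| := by
      rw [P.dq_of_le kv ka h, P.dq_of_le kv ka hp.le, P.dq_of_le kv ka le_rfl]
      rcases le_total 0 ka with hk | hk
      · refine abs_le_max_abs_abs ?_ ?_
        · nlinarith [ht.1]
        · nlinarith
      · rw [max_comm]
        refine abs_le_max_abs_abs ?_ ?_
        · nlinarith
        · nlinarith [ht.1]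
    rcases le_max_iff.1 hmax with h | h
    · exact ⟨0, h⟩
    · exact ⟨2, h⟩
  · refine ⟨2, ?_⟩
    change _ ≤ |P.dq kv ka P.tplan|
    rw [P.dq_of_ge kv ka h, P.dq_of_ge kv ka le_rfl, abs_mul, abs_mul,
      abs_of_nonneg (sub_nonneg.2 ht.2), abs_of_pos (sub_pos.2 P.tplan_lt)]
    gcongr

/-- The position at time `t` lies between the positions at the times `a` and `b`. -/
def QBetween (a t b : ℝ) : Prop :=
  (P.q kv ka a ≤ P.q kv ka t ∧ P.q kv ka t ≤ P.q kv ka b) ∨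
    (P.q kv ka b ≤ P.q kv ka t ∧ P.q kv ka t ≤ P.q kv ka a)

/-- If the velocity does not change sign between two times of the acceleration phase, an
intermediate position lies between the positions at these times. -/
lemma qBetween_of_le_tplan {a t b : ℝ} (h0 : 0 ≤ a) (hat : a ≤ t) (htb : t ≤ b)
    (hb : b ≤ P.tplan) (h : 0 ≤ (kv + ka * a) * (kv + ka * b)) : P.QBetween kv ka a t b := by
  rw [QBetween, P.q_of_le kv ka h0 (hat.trans (htb.trans hb)),
    P.q_of_le kv ka (h0.trans hat) (htb.trans hb),
    P.q_of_le kv ka (h0.trans (hat.trans htb)) hb]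
  -- `2 (q y - q x) = (y - x) (v x + v y)` for the affine velocity `v`
  rcases mul_nonneg_iff.1 h with ⟨ha, hb⟩ | ⟨ha, hb⟩
  · have ht : 0 ≤ kv + ka * t := by
      rcases le_total 0 ka with hk | hk <;> nlinarith
    left
    constructor
    · linarith [mul_nonneg (sub_nonneg.2 hat) (add_nonneg ha ht)]
    · linarith [mul_nonneg (sub_nonneg.2 htb) (add_nonneg ht hb)]
  · have ht : kv + ka * t ≤ 0 := by
      rcases le_total 0 ka with hk | hk <;> nlinarith
    right
    constructor
    · linarith [mul_nonpos_of_nonneg_of_nonpos (sub_nonneg.2 htb) (add_nonpos ht hb)]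
    · linarith [mul_nonpos_of_nonneg_of_nonpos (sub_nonneg.2 hat) (add_nonpos ha ht)]

/-- The braking phase is monotone. -/
lemma qBetween_of_tplan_le {t : ℝ} (hp : P.tplan ≤ t) (hf : t ≤ P.tf) :
    P.QBetween kv ka P.tplan t P.tf := by
  rw [QBetween, P.q_of_ge kv ka hp, P.q_of_ge kv ka (hp.trans hf)]
  set w := (kv + ka * P.tplan) / (P.tf - P.tplan)
  have h1 : 0 ≤ ((P.tf - P.tplan) ^ 2 - (P.tf - t) ^ 2) / 2 := by nlinarith
  have h2 : ((P.tf - P.tplan) ^ 2 - (P.tf - t) ^ 2) / 2 ≤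
      ((P.tf - P.tplan) ^ 2 - (P.tf - P.tf) ^ 2) / 2 := by nlinarith [sq_nonneg (P.tf - t)]
  rcases le_total 0 w with hw | hw
  · left
    exact ⟨le_add_of_nonneg_right (mul_nonneg hw h1),
      by linarith [mul_le_mul_of_nonneg_left h2 hw]⟩
  · right
    exact ⟨by linarith [mul_le_mul_of_nonpos_left h2 hw],
      add_le_of_nonpos_right (mul_nonpos_of_nonpos_of_nonneg hw h1)⟩

/-- Before and after the clipped zero of the velocity, the velocity does not change sign during the
acceleration phase. -/
lemma velocity_sign {c : ℝ} (hc : c = max 0 (min P.tplan (-kv / ka))) :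
    0 ≤ (kv + ka * 0) * (kv + ka * c) ∧ 0 ≤ (kv + ka * c) * (kv + ka * P.tplan) := by
  by_cases hk : ka = 0
  · subst hk
    simp [mul_self_nonneg]
  have hp := P.tplan_pos
  set τ := -kv / ka with hτ
  have hkv : kv = -(ka * τ) := by
    rw [hτ]
    field_simp
  have hsign : 0 ≤ (0 - τ) * (c - τ) ∧ 0 ≤ (c - τ) * (P.tplan - τ) := by
    rcases le_total τ 0 with h | h
    · rw [hc, min_eq_right (h.trans hp.le), max_eq_left h]
      constructor <;> nlinarith
    · rcases le_total τ P.tplan with h' | h'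
      · rw [hc, min_eq_right h', max_eq_right h]
        simp
      · rw [hc, min_eq_left h', max_eq_right hp.le]
        constructor <;> nlinarith
  have hk2 := sq_nonneg ka
  rw [hkv]
  constructor
  · linarith [mul_nonneg hk2 hsign.1]
  · linarith [mul_nonneg hk2 hsign.2]

/-- Every position is bounded above and below by positions at extremal times. -/
lemma exists_q_le_q_le {t : ℝ} (ht : t ∈ Set.Icc 0 P.tf) :
    ∃ c d, P.q kv ka (extremalTimes P kv ka c) ≤ P.q kv ka t ∧
      P.q kv ka t ≤ P.q kv ka (extremalTimes P kv ka d) := by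
  have of_between : ∀ c d,
      P.QBetween kv ka (extremalTimes P kv ka c) t (extremalTimes P kv ka d) →
      ∃ c d, P.q kv ka (extremalTimes P kv ka c) ≤ P.q kv ka t ∧
        P.q kv ka t ≤ P.q kv ka (extremalTimes P kv ka d) := by
    rintro c d (h | h)
    · exact ⟨c, d, h⟩
    · exact ⟨d, c, h⟩
  have hp := P.tplan_pos.le
  have hc0 : 0 ≤ max 0 (min P.tplan (-kv / ka)) := le_max_left _ _
  have hcp : max 0 (min P.tplan (-kv / ka)) ≤ P.tplan := max_le hp (min_le_left _ _)
  obtain ⟨h1, h2⟩ := P.velocity_sign kv ka rfl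
  rcases le_total t P.tplan with h | h
  · rcases le_total t (max 0 (min P.tplan (-kv / ka))) with h' | h'
    · exact of_between 0 1 (P.qBetween_of_le_tplan kv ka le_rfl ht.1 h' hcp h1)
    · exact of_between 1 2 (P.qBetween_of_le_tplan kv ka hc0 h' h le_rfl h2)
  · exact of_between 2 3 (P.qBetween_of_tplan_le kv ka h ht.2)

end PlanSpec

lemma le_hlim {n : ℕ} (arm : Arm n) (P : PlanSpec n) (q0 dq0 ka : Fin n → ℝ) (i : Fin n)
    (c : Fin 4) :
    max (max (arm.qmin i - (q0 i + P.q (dq0 i) (ka i) (extremalTimes P (dq0 i) (ka i) c)))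
      ((q0 i + P.q (dq0 i) (ka i) (extremalTimes P (dq0 i) (ka i) c)) - arm.qmax i))
      (|P.dq (dq0 i) (ka i) (extremalTimes P (dq0 i) (ka i) c)| - arm.dqmax i) ≤
    hlim arm P q0 dq0 ka := by
  refine le_trans ?_ (le_ciSup (Set.finite_range _).bddAbove i)
  exact le_ciSup (f := fun c => max (max
      (arm.qmin i - (q0 i + P.q (dq0 i) (ka i) (extremalTimes P (dq0 i) (ka i) c)))
      ((q0 i + P.q (dq0 i) (ka i) (extremalTimes P (dq0 i) (ka i) c)) - arm.qmax i))
      (|P.dq (dq0 i) (ka i) (extremalTimes P (dq0 i) (ka i) c)| - arm.dqmax i))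
    (Set.finite_range _).bddAbove c

theorem theorem1 {n : ℕ} (arm : Arm n) (P : PlanSpec n) :
    -- zonotope representations of the joint reachable sets exist
    (∃ J : Fin n → Fin P.N → JRSZonotope, P.IsJRS arm J) ∧
    -- and with any of them, every feasible parameter is safe
    ∀ (J : Fin n → Fin P.N → JRSZonotope), P.IsJRS arm J →
    -- zonotopes that enclose the link volumes
    ∀ (Lz : Fin n → Zonotope Vec3), (∀ i, arm.vol i ⊆ (Lz i).toSet) →
    -- finitely many compact obstacles and zonotopes that enclose them
    ∀ (m : ℕ) (O : Fin m → Set Vec3), (∀ o, IsCompact (O o)) →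
    ∀ (Oz : Fin m → Zonotope Vec3), (∀ o, O o ⊆ (Oz o).toSet) →
    -- initial joint angles and velocities
    ∀ (q0 dq0 : Fin n → ℝ), (∀ i, dq0 i ∈ P.Kv i) →
    -- half-space representations of the buffered obstacles
    ∀ (H : Fin n → Fin P.N → Fin m → Halfspaces),
      (∀ i s o, (H i s o).Represents
        (bufferedObstacle (composeRS arm P J Lz q0 dq0 i s) (Oz o)).toSet) →
    ∀ (ka : Fin n → ℝ), Feasible arm P q0 dq0 (composeRS arm P J Lz q0 dq0) H ka →
    ∀ t ∈ Set.Icc 0 P.tf,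
      (∀ o, arm.FO (fun i => q0 i + P.q (dq0 i) (ka i) t) ∩ O o = ∅) ∧
      ∀ i, arm.qmin i ≤ q0 i + P.q (dq0 i) (ka i) t ∧
        q0 i + P.q (dq0 i) (ka i) t ≤ arm.qmax i ∧
        |P.dq (dq0 i) (ka i) t| ≤ arm.dqmax i := by
  refine ⟨P.exists_isJRS arm, ?_⟩
  intro J hJ Lz hL m O _ Oz hO q0 dq0 hdq H hH ka hfeas t ht
  refine ⟨fun o => ?_, fun i => ?_⟩
  · rw [← Set.disjoint_iff_inter_eq_empty, Set.disjoint_left]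
    intro z hz hzO
    obtain ⟨i, hzi⟩ := Set.mem_iUnion.1 hz
    obtain ⟨β, hβ, hβa, rfl⟩ := exists_eval_composeRS hJ hL hdq hfeas.mem ht i hzi
    exact notMem_of_hobs_neg (hH i _ o) (hfeas.obs i t ht o)
      (evalKa_mem_bufferedObstacle P _ hβ hβa (hO o hzO))
  · have hlt := fun c => (le_hlim arm P q0 dq0 ka i c).trans_lt hfeas.lim
    simp only [max_lt_iff] at hlt
    obtain ⟨c, d, hc, hd⟩ := P.exists_q_le_q_le (dq0 i) (ka i) ht
    obtain ⟨e, he⟩ := P.exists_abs_dq_le (dq0 i) (ka i) ht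
    refine ⟨?_, ?_, ?_⟩
    · linarith [(hlt c).1.1]
    · linarith [(hlt d).1.2]
    · linarith [(hlt e).2]
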